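/- Let $K$ be a non-archimedean local field with ring of integers $\mathcal O$, uniformizer $\pi$ and residue field of order $q$. Let $\mathbf G$ be an absolutely almost simple linear algebraic group over $K$ of dimension $\delta$, with a fixed $K$-embedding $\mathbf G\hookrightarrow \mathrm{GL}_n$. Let $U$ be an open subgroup of $\mathbf G(K)$ contained in $\mathbf G(K)\cap \mathrm{GL}_n(\mathcal O)$ (for instance $U=\mathbf G(K)\cap \mathrm{GL}_n(\mathcal O)$), let $U_k=\ker\big(U\to \mathrm{GL}_n(\mathcal O/\pi^k\mathcal O)\big)$, let $\bar\gamma(U/U_k)$ be the number of conjugacy classes of the finite group $U/U_k$, and put $$\gamma=\limsup_{k\to\infty}\frac{\log_q \bar\gamma(U/U_k)}{k}.$$ Let $r_i(U)$ be the number (possibly infinite) of isomorphism classes of $i$-dimensional continuous irreducible complex representations of $U$, let $R_N(U)=\sum_{i=1}^N r_i(U)$, and let $\rho(U)=\limsup_{N\to\infty}\frac{\log R_N(U)}{\log N}\in[0,\infty]$. Then $\gamma\le\delta$ and $$\rho(U)\ \ge\ \frac{2\gamma}{\delta-\gamma}.$$ In other words, with $\mu=\gamma/\delta$, one has $\rho(U)\ge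 \frac{2\mu}{1-\mu}$. (If $\gamma=\delta$, the right-hand sides are read as $\infty$.) -/

import Mathlib

open scoped ENNReal ValuativeRel

noncomputable section

universe u v

/-! ### Linear algebraic groups -/

/-- The invertible matrix `g` over the `K`-algebra `R` is a common zero of the polynomials in `I`,
which are polynomials over `K` in the `n * n` matrix entries. -/
def VanishesOn {K : Type u} [Field K] {n : ℕ} (I : Ideal (MvPolynomial (Fin n × Fin n) K))
    {R : Type v} [CommRing R] [Algebra K R] (g : GL (Fin n) R) : Prop :=
  ∀ f ∈ I, MvPolynomial.aeval (fun ij => (g : Matrix (Fin n) (Fin n) R) ij.1 ij.2) f = 0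

/-- The coordinate ring of the closed subscheme of `GL_n` over `K` cut out by `I`: the quotient of
the polynomial ring in the matrix entries by `I`, with the determinant inverted. -/
abbrev CoordinateRing {K : Type u} [Field K] {n : ℕ}
    (I : Ideal (MvPolynomial (Fin n × Fin n) K)) : Type u :=
  Localization.Away (Ideal.Quotient.mk I (Matrix.mvPolynomialX (Fin n) (Fin n) K).det)

/-- A linear algebraic group over `K` together with a `K`-embedding in `GL_n`: a closed subscheme
of `GL_n` over `K` that is smooth over `K` and whose `R`-points form a subgroup of `GL_n(R)` for
every commutative `K`-algebra `R`. -/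
structure LinearAlgebraicGroup (K : Type u) [Field K] (n : ℕ) where
  /-- equations of the group in the matrix entries -/
  ideal : Ideal (MvPolynomial (Fin n × Fin n) K)
  one_mem : ∀ (R : Type u) [CommRing R] [Algebra K R],
    VanishesOn ideal (1 : GL (Fin n) R)
  mul_mem : ∀ (R : Type u) [CommRing R] [Algebra K R] (g h : GL (Fin n) R),
    VanishesOn ideal g → VanishesOn ideal h → VanishesOn ideal (g * h)
  inv_mem : ∀ (R : Type u) [CommRing R] [Algebra K R] (g : GL (Fin n) R),
    VanishesOn ideal g → VanishesOn ideal g⁻¹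
  smooth : Algebra.Smooth K (CoordinateRing ideal)

namespace LinearAlgebraicGroup

/-- The group `G(R)` of `R`-points, a subgroup of `GL_n(R)`. -/
def points {K : Type u} [Field K] {n : ℕ} (G : LinearAlgebraicGroup K n)
    (R : Type u) [CommRing R] [Algebra K R] : Subgroup (GL (Fin n) R) where
  carrier := {g | VanishesOn G.ideal g}
  mul_mem' := fun {g h} hg hh => G.mul_mem R g h hg hh
  one_mem' := G.one_mem R
  inv_mem' := fun {g} hg => G.inv_mem R g hg

/-- The dimension of `G`, as the Krull dimension of its coordinate ring. -/
def dim {K : Type u} [Field K] {n : ℕ} (G : LinearAlgebraicGroup K n) : WithBot ℕ∞ :=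
  ringKrullDim (CoordinateRing G.ideal)

end LinearAlgebraicGroup

/-- A set of invertible matrices over a field `L` is Zariski closed in `GL_n(L)`. -/
def IsZariskiClosed {L : Type u} [Field L] {n : ℕ} (S : Set (GL (Fin n) L)) : Prop :=
  ∃ J : Ideal (MvPolynomial (Fin n × Fin n) L), S = {g | VanishesOn J g}

/-- `G` is absolutely almost simple: over an algebraic closure `L` of `K` it is non-commutative,
connected, and each of its Zariski closed normal subgroups is finite or the whole group. -/
structure LinearAlgebraicGroup.IsAbsolutelyAlmostSimple {K : Type u} [Field K] {n : ℕ}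
    (G : LinearAlgebraicGroup K n) : Prop where
  noncommutative : ∃ g ∈ G.points (AlgebraicClosure K), ∃ h ∈ G.points (AlgebraicClosure K),
    g * h ≠ h * g
  /-- a linear algebraic group is connected iff it has no proper closed subgroup of finite index -/
  connected : ∀ H : Subgroup (GL (Fin n) (AlgebraicClosure K)),
    IsZariskiClosed (H : Set (GL (Fin n) (AlgebraicClosure K))) →
    H ≤ G.points (AlgebraicClosure K) →
    (H.subgroupOf (G.points (AlgebraicClosure K))).FiniteIndex →
    H = G.points (AlgebraicClosure K)
  normal_subgroups : ∀ N : Subgroup (GL (Fin n) (AlgebraicClosure K)),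
    IsZariskiClosed (N : Set (GL (Fin n) (AlgebraicClosure K))) →
    N ≤ G.points (AlgebraicClosure K) →
    (N.subgroupOf (G.points (AlgebraicClosure K))).Normal →
    Finite N ∨ N = G.points (AlgebraicClosure K)

/-! ### Representation growth -/

/-- The representation of `Γ` on `ℂ ^ d` given by a homomorphism to `GL_d(ℂ)`. -/
def matrixRep {Γ : Type u} [Group Γ] {d : ℕ} (φ : Γ →* GL (Fin d) ℂ) :
    Representation ℂ Γ (Fin d → ℂ) :=
  (Units.coeHom _).comp (Matrix.GeneralLinearGroup.toLin.toMonoidHom.comp φ)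

/-- Continuous irreducible `d`-dimensional complex matrix representations of a topological group. -/
def IrrRep (Γ : Type u) [Group Γ] [TopologicalSpace Γ] (d : ℕ) : Type u :=
  {φ : Γ →* GL (Fin d) ℂ // Continuous φ ∧ (matrixRep φ).IsIrreducible}

/-- Isomorphism of matrix representations: conjugacy by an element of `GL_d(ℂ)`. -/
def irrRepSetoid (Γ : Type u) [Group Γ] [TopologicalSpace Γ] (d : ℕ) : Setoid (IrrRep Γ d) where
  r φ ψ := ∃ P : GL (Fin d) ℂ, ∀ g, ψ.1 g = P * φ.1 g * P⁻¹
  iseqv :=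
    { refl := fun φ => ⟨1, fun g => by simp⟩
      symm := fun {φ ψ} ⟨P, hP⟩ => ⟨P⁻¹, fun g => by simp [hP g, mul_assoc]⟩
      trans := fun {φ ψ χ} ⟨P, hP⟩ ⟨Q, hQ⟩ =>
        ⟨Q * P, fun g => by simp [hP g, hQ g, mul_assoc]⟩ }

/-- `r_d(Γ)`: the number (possibly infinite) of isomorphism classes of continuous irreducible
complex representations of `Γ` of dimension `d`. -/
def numIrr (Γ : Type u) [Group Γ] [TopologicalSpace Γ] (d : ℕ) : ℕ∞ :=
  ENat.card (Quotient (irrRepSetoid Γ d))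

/-- `R_N(Γ) = r_1(Γ) + ... + r_N(Γ)`. -/
def numIrrLE (Γ : Type u) [Group Γ] [TopologicalSpace Γ] (N : ℕ) : ℕ∞ :=
  ∑ d ∈ Finset.Icc 1 N, numIrr Γ d

/-- The abscissa `ρ(Γ) = limsup log R_N(Γ) / log N`, as an extended real number
(with `log ∞ = ∞`). -/
def abscissa (Γ : Type u) [Group Γ] [TopologicalSpace Γ] : EReal :=
  Filter.limsup
    (fun N : ℕ => ENNReal.log ((numIrrLE Γ N : ℕ∞) : ℝ≥0∞) / ((Real.log (N : ℝ) : ℝ) : EReal))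
    Filter.atTop

/-! ### Integral points and congruence quotients over a non-archimedean local field -/

section LocalField

variable (K : Type u) [Field K] [ValuativeRel K] [TopologicalSpace K]
  [IsNonarchimedeanLocalField K]

/-- The inclusion of `GL_n(𝒪)` in `GL_n(K)`. -/
def integralInclusion (n : ℕ) : GL (Fin n) 𝒪[K] →* GL (Fin n) K :=
  Matrix.GeneralLinearGroup.map (algebraMap 𝒪[K] K)

variable {K}

/-- `G(K) ∩ GL_n(𝒪)`, as a subgroup of `GL_n(𝒪)`. -/
def LinearAlgebraicGroup.integralPoints {n : ℕ} (G : LinearAlgebraicGroup K n) :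
    Subgroup (GL (Fin n) 𝒪[K]) :=
  (G.points K).comap (integralInclusion K n)

/-- `U`, seen as a set of `K`-points of `G`, is open in `G(K)`. -/
def IsOpenInPoints {n : ℕ} (G : LinearAlgebraicGroup K n) (U : Subgroup (GL (Fin n) 𝒪[K])) :
    Prop :=
  IsOpen {g : G.points K | (g : GL (Fin n) K) ∈ U.map (integralInclusion K n)}

/-- The congruence subgroup `U_k`, the kernel of `U → GL_n(𝒪 / π ^ k)`; here `(π ^ k)` is the
`k`-th power of the maximal ideal. -/
def congruenceSubgroup {n : ℕ} (U : Subgroup (GL (Fin n) 𝒪[K])) (k : ℕ) : Subgroup U :=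
  ((Matrix.GeneralLinearGroup.map (n := Fin n) (Ideal.Quotient.mk (𝓂[K] ^ k))).comp
    U.subtype).ker

instance {n : ℕ} (U : Subgroup (GL (Fin n) 𝒪[K])) (k : ℕ) : (congruenceSubgroup U k).Normal :=
  inferInstanceAs (MonoidHom.ker _).Normal

/-- The number of conjugacy classes of the finite group `U / U_k`. -/
def numConjClasses {n : ℕ} (U : Subgroup (GL (Fin n) 𝒪[K])) (k : ℕ) : ℕ :=
  Nat.card (ConjClasses (U ⧸ congruenceSubgroup U k))

/-- `γ(U) = limsup (log_q #(conjugacy classes of U / U_k)) / k`, where `q` is the order of the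
residue field. The terms are non-negative real numbers. -/
def classGrowth {n : ℕ} (U : Subgroup (GL (Fin n) 𝒪[K])) : ℝ≥0∞ :=
  Filter.limsup
    (fun k : ℕ => ENNReal.ofReal
      (Real.logb (Nat.card 𝓀[K] : ℝ) (numConjClasses U k : ℝ) / (k : ℝ)))
    Filter.atTop

end LocalField

end

/-!
The proof plays off, for the finite quotients `H = U / U_k`, the number of irreducible
representations against their total size. By the Wedderburn-Artin theorem applied to the group
algebra, `H` has at least `c_k` irreducible representations, `c_k` being its number of conjugacy
classes, and the squares of their dimensions add up to `|H|` (`exists_irreducible_family`). Hence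
at most `|H| / (N + 1) ^ 2` of them have dimension above `N`, and the others, inflated to `U`, are
counted by `R_N(U)` (`exists_le_numIrrLE`).

The second ingredient is the bound `|U / U_k| ≤ C q ^ (δ k)`
(`exists_card_quotient_congruenceSubgroup_le`). As `G` is smooth, it has at the identity a standard
smooth neighbourhood, given by `a` generators and `b` relations whose module of differentials is
free of rank `a - b`; by Krull's height theorem `a - b` is at most the Krull dimension `δ`. So the
tangent space at the identity has dimension at most `δ` (`finrank_tangentSpace_le`). It follows
that `δ` linear forms, together with the differentials at the identity of equations of `G`, span
all linear forms in the matrix entries. By Taylor expansion the differential of an equation of `G`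
is negligible on the difference of two points of `G` that are close to the identity, so the `δ`
forms alone determine such points modulo `𝔪 ^ k`, up to a fixed loss of precision
(`exists_linearForms_separating_points`). By homogeneity the bound on a fixed congruence subgroup
gives the bound for `U`.

Since `c_k ≤ |U / U_k|`, this gives `γ ≤ δ`. For `γ' < γ` there are infinitely many `k` with
`c_k ≥ q ^ (γ' k)`, and with `N` about `(2 C q ^ ((δ - γ') k)) ^ (1 / 2)` there are at least
`q ^ (γ' k) / 2` representations of dimension at most `N`. Then `log R_N / log N` is at least about
`2 γ' / (δ - γ')` (`le_limsup_log_div_log`), and `γ'` tends to `γ`.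
-/

universe u v

/-! ### Irreducible representations of a finite group -/

/-- A linear functional on a product of matrix algebras that satisfies `τ (x * y) = τ (y * x)` is
determined by its values on one diagonal matrix unit in each factor. -/
theorem tracial_eq_zero_of_matrixUnit {r : ℕ} {d : Fin r → ℕ} [∀ i, NeZero (d i)]
    (τ : (Π i, Matrix (Fin (d i)) (Fin (d i)) ℂ) →ₗ[ℂ] ℂ) (hτ : ∀ x y, τ (x * y) = τ (y * x))
    (h0 : ∀ i, τ (Pi.single i (Matrix.single 0 0 1)) = 0) : τ = 0 := by
  have key : ∀ i (a b : Fin (d i)), τ (Pi.single i (Matrix.single a b 1)) = 0 := by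
    intro i a b
    have hm : ∀ p q s t : Fin (d i),
        τ (Pi.single i (Matrix.single p q (1 : ℂ) * Matrix.single s t 1)) =
          τ (Pi.single i (Matrix.single s t (1 : ℂ) * Matrix.single p q 1)) := by
      intro p q s t
      rw [Pi.single_mul, Pi.single_mul, hτ]
    by_cases hab : a = b
    · subst hab
      have := hm a 0 0 a
      simp only [Matrix.single_mul_single_same, mul_one] at this
      rw [this, h0]
    · have := hm a a a b
      rw [Matrix.single_mul_single_same, Matrix.single_mul_single_of_ne _ _ _ _ (Ne.symm hab)]
        at this
      simpa using this
  refine LinearMap.pi_ext' fun i => ?_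
  refine Matrix.ext_linearMap _ fun a b => ?_
  ext
  simpa using key i a b

/-- A function on the set of conjugacy classes of a group, extended linearly to a functional on the
group algebra. -/
noncomputable def classFunctional (H : Type u) [Group H] (f : ConjClasses H → ℂ) :
    MonoidAlgebra ℂ H →ₗ[ℂ] ℂ :=
  (MonoidAlgebra.basis H ℂ).constr ℂ fun h => f (ConjClasses.mk h)

theorem classFunctional_single {H : Type u} [Group H] (f : ConjClasses H → ℂ) (h : H) :
    classFunctional H f (MonoidAlgebra.single h 1) = f (ConjClasses.mk h) := by
  have := (MonoidAlgebra.basis H ℂ).constr_basis ℂ (fun h => f (ConjClasses.mk h)) h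
  simpa [classFunctional] using this

theorem classFunctional_mul_comm {H : Type u} [Group H] (f : ConjClasses H → ℂ)
    (x y : MonoidAlgebra ℂ H) : classFunctional H f (x * y) = classFunctional H f (y * x) := by
  have : ((LinearMap.mul ℂ _).compr₂ (classFunctional H f)) =
      ((LinearMap.mul ℂ _).flip.compr₂ (classFunctional H f)) := by
    refine (MonoidAlgebra.basis H ℂ).ext fun g => (MonoidAlgebra.basis H ℂ).ext fun h => ?_
    have hc : ConjClasses.mk (g * h) = ConjClasses.mk (h * g) :=
      ConjClasses.mk_eq_mk_iff_isConj.2 (isConj_iff.2 ⟨h, by group⟩)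
    simp [MonoidAlgebra.single_mul_single, classFunctional_single, hc]
  exact LinearMap.congr_fun₂ this x y

/-- If the values of `φ` span the algebra of all matrices, then `φ` is irreducible. -/
theorem matrixRep_isIrreducible {H : Type u} [Group H] {d : ℕ} [NeZero d] (φ : H →* GL (Fin d) ℂ)
    (hφ : Submodule.span ℂ (Set.range fun h => (φ h : Matrix (Fin d) (Fin d) ℂ)) = ⊤) :
    (matrixRep φ).IsIrreducible := by
  have hstab : ∀ (W : Subrepresentation (matrixRep φ)) (M : Matrix (Fin d) (Fin d) ℂ),
      ∀ w ∈ W.toSubmodule, M.mulVec w ∈ W.toSubmodule := by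
    intro W M w hw
    have hM : M ∈ Submodule.span ℂ (Set.range fun h => (φ h : Matrix (Fin d) (Fin d) ℂ)) := by
      rw [hφ]; trivial
    induction hM using Submodule.span_induction with
    | mem x hx =>
      obtain ⟨h, rfl⟩ := hx
      exact W.apply_mem_toSubmodule h hw
    | zero => simp
    | add x y _ _ hx hy => rw [Matrix.add_mulVec]; exact W.toSubmodule.add_mem hx hy
    | smul a x _ hx => rw [Matrix.smul_mulVec]; exact W.toSubmodule.smul_mem a hx
  refine { exists_pair_ne := ⟨⊥, ⊤, fun h => ?_⟩, eq_bot_or_eq_top := fun W => ?_ }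
  · have h' : (⊥ : Submodule ℂ (Fin d → ℂ)) = ⊤ := congrArg Subrepresentation.toSubmodule h
    exact bot_ne_top h'
  · by_cases hW : W.toSubmodule = ⊥
    · exact Or.inl (Subrepresentation.toSubmodule_injective hW)
    · right
      apply Subrepresentation.toSubmodule_injective
      obtain ⟨w, hw, hw0⟩ := Submodule.exists_mem_ne_zero_of_ne_bot hW
      obtain ⟨i, hi⟩ := Function.ne_iff.1 hw0
      refine Submodule.eq_top_iff'.2 fun v => ?_
      have := hstab W (Matrix.vecMulVec v (Pi.single i (w i)⁻¹)) w hw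
      rw [Matrix.vecMulVec_mulVec] at this
      simpa [inv_mul_cancel₀ hi] using this

/-- A finite group `H` has a family of matrix representations with distinct characters, each with
values spanning the full matrix algebra (so irreducible), indexed by at least as many elements as
`H` has conjugacy classes, and such that the squares of the dimensions add up to the order of `H`.
They are the projections of the group algebra to its simple factors. -/
theorem exists_irreducible_family (H : Type u) [Group H] [Finite H] :
    ∃ (r : ℕ) (d : Fin r → ℕ) (φ : ∀ i, H →* GL (Fin (d i)) ℂ),
      (∀ i, 0 < d i) ∧ Nat.card (ConjClasses H) ≤ r ∧ ∑ i, d i ^ 2 = Nat.card H ∧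
      (∀ i, Submodule.span ℂ (Set.range fun h => (φ i h : Matrix (Fin (d i)) (Fin (d i)) ℂ)) = ⊤) ∧
      Function.Injective fun i h => (φ i h : Matrix (Fin (d i)) (Fin (d i)) ℂ).trace := by
  classical
  have : Fintype H := Fintype.ofFinite H
  have : NeZero (Nat.card H : ℂ) := ⟨by simp⟩
  have : Module.Finite ℂ (MonoidAlgebra ℂ H) := Module.Finite.of_basis (MonoidAlgebra.basis H ℂ)
  obtain ⟨r, d, hd, ⟨e⟩⟩ :=
    IsSemisimpleRing.exists_algEquiv_pi_matrix_of_isAlgClosed ℂ (MonoidAlgebra ℂ H)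
  let p : ∀ i, MonoidAlgebra ℂ H →ₐ[ℂ] Matrix (Fin (d i)) (Fin (d i)) ℂ := fun i =>
    (Pi.evalAlgHom ℂ _ i).comp e.toAlgHom
  let φ : ∀ i, H →* GL (Fin (d i)) ℂ := fun i =>
    ((p i : MonoidAlgebra ℂ H →* _).comp (MonoidAlgebra.of ℂ H)).toHomUnits
  have hφ : ∀ i h, (φ i h : Matrix (Fin (d i)) (Fin (d i)) ℂ) = e (MonoidAlgebra.single h 1) i :=
    fun i h => rfl
  have hsp : Submodule.span ℂ (Set.range fun h => (MonoidAlgebra.single h 1 : MonoidAlgebra ℂ H))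
      = ⊤ := by
    have := (MonoidAlgebra.basis H ℂ).span_eq
    convert! this using 3
  refine ⟨r, d, φ, fun i => Nat.pos_of_ne_zero (hd i).out, ?_, ?_, fun i => ?_, ?_⟩
  · let T : (ConjClasses H → ℂ) →ₗ[ℂ] (Fin r → ℂ) :=
      { toFun := fun f i => classFunctional H f (e.symm (Pi.single i (Matrix.single 0 0 1)))
        map_add' := fun f g => by
          ext i
          have : classFunctional H (f + g) = classFunctional H f + classFunctional H g := by
            refine (MonoidAlgebra.basis H ℂ).ext fun h => by simp [classFunctional_single]
          simp [this]
        map_smul' := fun c f => by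
          ext i
          have : classFunctional H (c • f) = c • classFunctional H f := by
            refine (MonoidAlgebra.basis H ℂ).ext fun h => by simp [classFunctional_single]
          simp [this] }
    have hT : Function.Injective T := by
      rw [← LinearMap.ker_eq_bot, LinearMap.ker_eq_bot']
      intro f hf
      have h0 : (classFunctional H f).comp e.symm.toLinearMap = 0 := by
        refine tracial_eq_zero_of_matrixUnit _ (fun x y => ?_) fun i => congrFun hf i
        simp [classFunctional_mul_comm f (e.symm x)]
      ext c
      obtain ⟨h, rfl⟩ := ConjClasses.mk_surjective c
      rw [← classFunctional_single f h]
      simpa using LinearMap.congr_fun h0 (e (MonoidAlgebra.single h 1))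
    have : Fintype (ConjClasses H) := Fintype.ofFinite _
    simpa [Nat.card_eq_fintype_card] using LinearMap.finrank_le_finrank_of_injective hT
  · have h1 := e.toLinearEquiv.finrank_eq
    rw [Module.finrank_eq_card_basis (MonoidAlgebra.basis H ℂ), Module.finrank_pi_fintype] at h1
    simp only [Module.finrank_matrix, Fintype.card_fin, Module.finrank_self, mul_one] at h1
    rw [Nat.card_eq_fintype_card, h1]
    exact Finset.sum_congr rfl fun i _ => sq _
  · have hs : Function.Surjective (p i) :=
      (Function.surjective_eval i).comp e.surjective
    have h2 := congrArg (Submodule.map (p i).toLinearMap) hsp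
    rw [Submodule.map_span, ← Set.range_comp, Submodule.map_top, LinearMap.range_eq_top.2 hs] at h2
    exact h2
  · intro i j hij
    by_contra hne
    -- the two characters extend to the same functional on the product of matrix algebras
    have hlin : (Matrix.traceLinearMap (Fin (d i)) ℂ ℂ).comp (p i).toLinearMap =
        (Matrix.traceLinearMap (Fin (d j)) ℂ ℂ).comp (p j).toLinearMap := by
      refine (MonoidAlgebra.basis H ℂ).ext fun h => ?_
      have := congrFun hij h
      simpa [hφ, p] using this
    have h1 := LinearMap.congr_fun hlin (e.symm (Pi.single i 1))
    have h2 := (hd i).out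
    simp [p, Pi.single_eq_of_ne (Ne.symm hne), h2] at h1

/-- Let `Γ` map onto a finite group `H` with `c` conjugacy classes by a locally constant
homomorphism. Then `R_N(Γ)` is at least `c - |H| / (N + 1) ^ 2`: this many of the irreducible
representations of `H` have dimension at most `N`, as the squares of all dimensions add up to `|H|`,
and distinct characters keep them non-isomorphic over `Γ`. -/
theorem exists_le_numIrrLE {Γ : Type u} [Group Γ] [TopologicalSpace Γ] {H : Type v} [Group H]
    [Finite H] (q : Γ →* H) (hq : Function.Surjective q) (hqc : IsLocallyConstant q) (N : ℕ) :
    ∃ s : ℕ, (s : ℕ∞) ≤ numIrrLE Γ N ∧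
      Nat.card (ConjClasses H) * (N + 1) ^ 2 ≤ s * (N + 1) ^ 2 + Nat.card H := by
  classical
  obtain ⟨r, d, φ, hd, hr, hsum, hsp, hinj⟩ := exists_irreducible_family H
  have hex : ∀ (m : ℕ) (i : {i // d i = m}), ∃ ψ : IrrRep Γ m, ∀ g,
      (ψ.1 g : Matrix (Fin m) (Fin m) ℂ).trace =
        (φ i (q g) : Matrix (Fin (d i)) (Fin (d i)) ℂ).trace := by
    rintro _ ⟨i, rfl⟩
    have : NeZero (d i) := ⟨(hd i).ne'⟩
    refine ⟨⟨(φ i).comp q, (hqc.comp (φ i)).continuous, matrixRep_isIrreducible _ ?_⟩, fun g => rfl⟩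
    rw [← hsp i]
    congr 1
    exact hq.range_comp fun h => (φ i h : Matrix (Fin (d i)) (Fin (d i)) ℂ)
  choose ψ hψ using hex
  have hcard : ∀ m, ((Finset.univ.filter fun i => d i = m).card : ℕ∞) ≤ numIrr Γ m := by
    intro m
    have hin : Function.Injective fun i : {i // d i = m} =>
        (Quotient.mk (irrRepSetoid Γ m) (ψ m i)) := by
      intro i j hij
      obtain ⟨P, hP⟩ := Quotient.exact hij
      refine Subtype.ext (hinj (funext fun h => ?_))
      obtain ⟨g, rfl⟩ := hq h
      change (φ i (q g) : Matrix (Fin (d i)) (Fin (d i)) ℂ).trace =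
        (φ j (q g) : Matrix (Fin (d j)) (Fin (d j)) ℂ).trace
      rw [← hψ, ← hψ, hP g]
      simp only [Units.val_mul]
      rw [Matrix.trace_mul_comm, ← mul_assoc, ← Units.val_mul, inv_mul_cancel, Units.val_one,
        one_mul]
    have := ENat.card_le_card_of_injective hin
    rwa [ENat.card_eq_coe_fintype_card, Fintype.card_subtype] at this
  refine ⟨(Finset.univ.filter fun i => d i ≤ N).card, ?_, ?_⟩
  · rw [Finset.card_eq_sum_card_fiberwise (f := d) (t := Finset.Icc 1 N)]
    · push_cast
      refine Finset.sum_le_sum fun m hm => le_trans ?_ (hcard m)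
      refine Nat.cast_le.2 (Finset.card_le_card ?_)
      rw [Finset.filter_filter]
      exact Finset.monotone_filter_right _ fun i _ hi => hi.2
    · intro i hi
      simp only [Finset.coe_filter, Finset.mem_univ, true_and, Set.mem_ofPred_eq] at hi
      exact Finset.mem_coe.2 (Finset.mem_Icc.2 ⟨hd i, hi⟩)
  · have h1 : (Finset.univ.filter fun i => ¬ d i ≤ N).card * (N + 1) ^ 2 ≤ Nat.card H := by
      rw [← hsum, ← smul_eq_mul, ← Finset.sum_const]
      refine (Finset.sum_le_sum fun i hi => ?_).trans
        (Finset.sum_le_univ_sum_of_nonneg fun i => Nat.zero_le _)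
      have := (Finset.mem_filter.1 hi).2
      exact Nat.pow_le_pow_left (by omega) 2
    have h2 := Finset.card_filter_add_card_filter_not (s := (Finset.univ : Finset (Fin r)))
      (fun i => d i ≤ N)
    rw [Finset.card_univ, Fintype.card_fin] at h2
    calc _ ≤ r * (N + 1) ^ 2 := Nat.mul_le_mul_right _ hr
      _ = ((Finset.univ.filter fun i => d i ≤ N).card +
          (Finset.univ.filter fun i => ¬ d i ≤ N).card) * (N + 1) ^ 2 := by rw [h2]
      _ ≤ _ := by rw [add_mul]; exact Nat.add_le_add_left h1 _

/-! ### The tangent space of a smooth affine scheme at a rational point -/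

theorem MvPolynomial.height_of_isMaximal_fin {K : Type u} [Field K] (n : ℕ)
    (m : Ideal (MvPolynomial (Fin n) K)) [m.IsMaximal] : m.height = n := by
  induction n with
  | zero =>
    have h0 : ringKrullDim (MvPolynomial (Fin 0) K) = 0 := by
      rw [MvPolynomial.ringKrullDim_of_isNoetherianRing, ringKrullDim_eq_zero_of_field]
      simp
    have := Ideal.height_le_ringKrullDim_of_ne_top (Ideal.IsMaximal.ne_top (I := m) inferInstance)
    rw [h0] at this
    simpa using this
  | succ n ih =>
    let e := (MvPolynomial.finSuccEquiv K n).toRingEquiv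
    let P : Ideal (Polynomial (MvPolynomial (Fin n) K)) := m.map e
    have : P.IsMaximal := Ideal.map_isMaximal_of_equiv e
    let p := P.comap (Polynomial.C : MvPolynomial (Fin n) K →+* _)
    have : p.IsMaximal := Polynomial.isMaximal_comap_C_of_isJacobsonRing P
    have : P.LiesOver p := ⟨rfl⟩
    have h := Polynomial.height_eq_height_add_one p P
    rw [ih p, e.height_map] at h
    exact_mod_cast h

theorem MvPolynomial.height_of_isMaximal {K : Type u} [Field K] {ι : Type*} [Finite ι]
    (m : Ideal (MvPolynomial ι K)) [m.IsMaximal] : m.height = Nat.card ι := by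
  let e := (MvPolynomial.renameEquiv K (Finite.equivFin ι)).toRingEquiv
  have : (m.map e).IsMaximal := Ideal.map_isMaximal_of_equiv e
  rw [← e.height_map, MvPolynomial.height_of_isMaximal_fin]

theorem ringKrullDim_localization_le {A : Type*} [CommRing A] (M : Submonoid A) (B : Type*)
    [CommRing B] [Algebra A B] [IsLocalization M B] : ringKrullDim B ≤ ringKrullDim A :=
  Order.krullDim_le_of_strictMono (PrimeSpectrum.comap (algebraMap A B))
    (Monotone.strictMono_of_injective (fun _ _ h => Ideal.comap_mono h)
      (PrimeSpectrum.localization_comap_injective B M))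

/-- For a submersive presentation with a rational point, Krull's height theorem bounds the number
of generators minus the number of relations by the dimension of the ring. -/
theorem Algebra.SubmersivePresentation.dimension_le_ringKrullDim {K B : Type*} [Field K]
    [CommRing B] [Algebra K B] {ι σ : Type*} [Finite ι] [Finite σ]
    (P : SubmersivePresentation K B ι σ)
    (ε : B →ₐ[K] K) : (P.dimension : WithBot ℕ∞) ≤ ringKrullDim B := by
  have := Fintype.ofFinite σ
  let φ : MvPolynomial ι K →ₐ[K] B := MvPolynomial.aeval P.val
  have hφ : Function.Surjective φ := fun b => ⟨P.σ b, P.aeval_val_σ b⟩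
  have hker : RingHom.ker φ = Ideal.span (Set.range P.relation) := by
    rw [P.span_range_relation_eq_ker, P.ker_eq_ker_aeval_val]
  let m : Ideal (MvPolynomial ι K) := RingHom.ker (ε.comp φ)
  have hm : m.IsMaximal := RingHom.ker_isMaximal_of_surjective _ fun a =>
    ⟨algebraMap K _ a, by simp⟩
  have hle : RingHom.ker φ ≤ m := fun f hf => by
    have : φ f = 0 := hf
    simp [m, this]
  have h1 := height_le_ringKrullDim_quotient_add_spanFinrank hle
  rw [MvPolynomial.height_of_isMaximal,
    ringKrullDim_eq_of_ringEquiv (Ideal.quotientKerAlgEquivOfSurjective hφ).toRingEquiv] at h1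
  have h2 : (RingHom.ker φ).spanFinrank ≤ Nat.card σ := by
    rw [hker]
    refine (Submodule.spanFinrank_span_le_ncard_of_finite (Set.finite_range _)).trans ?_
    rw [← Set.image_univ, ← Set.ncard_univ]
    exact Set.ncard_image_le Set.finite_univ
  have h3 : (Nat.card ι : WithBot ℕ∞) ≤ ringKrullDim B + (Nat.card σ : WithBot ℕ∞) :=
    h1.trans (by gcongr)
  have : Nontrivial B := ε.toRingHom.domain_nontrivial
  unfold Algebra.Presentation.dimension
  obtain ⟨D, hD⟩ : ∃ D : ℕ∞, ringKrullDim B = D :=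
    have hbot : ringKrullDim B ≠ ⊥ :=
      (ringKrullDim_nonneg_of_nontrivial.trans_lt' (WithBot.bot_lt_coe _)).ne'
    (WithBot.ne_bot_iff_exists.1 hbot).imp fun _ h => h.symm
  rw [hD] at h3 ⊢
  have h4 : (Nat.card ι : ℕ∞) ≤ D + Nat.card σ := by exact_mod_cast h3
  have h5 : ((Nat.card ι - Nat.card σ : ℕ) : ℕ∞) ≤ D := by
    rw [ENat.natCast_sub]
    exact tsub_le_iff_right.2 h4
  exact WithBot.coe_le_coe.2 h5

/-- The derivations of a standard smooth algebra at a rational point form a space of dimension the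
rank of the module of differentials, which is at most the Krull dimension. -/
theorem finrank_derivation_le_ringKrullDim {K B : Type*} [Field K] [CommRing B]
    [Algebra K B] [Algebra.IsStandardSmooth K B] [Algebra B K] [IsScalarTower K B K] :
    Module.Finite K (Derivation K B K) ∧
      (Module.finrank K (Derivation K B K) : WithBot ℕ∞) ≤ ringKrullDim B := by
  obtain ⟨ι, σ, _, _, ⟨P⟩⟩ := Algebra.IsStandardSmooth.out (R := K) (S := B)
  let ε : B →ₐ[K] K := IsScalarTower.toAlgHom K B K
  have : Nontrivial B := ε.toRingHom.domain_nontrivial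
  let b := P.basisKaehler
  let c := (b.constr K (M' := K)).trans
    ((KaehlerDifferential.linearMapEquivDerivation K B (M := K)).restrictScalars K)
  have := Fintype.ofFinite ((Set.range P.map)ᶜ : Set ι)
  refine ⟨Module.Finite.equiv c, ?_⟩
  rw [← c.finrank_eq, Module.finrank_fintype_fun_eq_card]
  refine le_trans (le_of_eq ?_) (P.dimension_le_ringKrullDim ε)
  have := P.rank_kaehlerDifferential
  rw [rank_eq_card_basis b] at this
  exact_mod_cast this

/-- The tangent space at the point `x` of the affine scheme cut out by `I`: the vectors on which the
differentials at `x` of all elements of `I` vanish. -/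
noncomputable def tangentSpace {K : Type u} [Field K] {τ : Type v} [Fintype τ]
    (I : Ideal (MvPolynomial τ K)) (x : τ → K) : Submodule K (τ → K) where
  carrier := {v | ∀ f ∈ I, ∑ i, MvPolynomial.eval x (MvPolynomial.pderiv i f) * v i = 0}
  add_mem' {v w} hv hw f hf := by
    simp [mul_add, Finset.sum_add_distrib, hv f hf, hw f hf]
  zero_mem' f _ := by simp
  smul_mem' c v hv f hf := by
    simp [mul_left_comm _ c, ← Finset.mul_sum, hv f hf]

open TrivSqZeroExt in
/-- The value of a polynomial at the point `x + v ε` over the dual numbers. -/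
theorem aeval_inl_add_inr {K : Type u} [Field K] {τ : Type v} [Fintype τ] (x v : τ → K)
    (f : MvPolynomial τ K) :
    MvPolynomial.aeval (fun i => (inl (x i) + inr (v i) : TrivSqZeroExt K K)) f =
      inl (MvPolynomial.eval x f) +
        inr (∑ i, MvPolynomial.eval x (MvPolynomial.pderiv i f) * v i) := by
  classical
  induction f using MvPolynomial.induction_on with
  | C a => ext <;> simp [TrivSqZeroExt.algebraMap_eq_inl]
  | add p q hp hq =>
    rw [map_add, hp, hq]
    ext <;> simp [add_mul, Finset.sum_add_distrib]
  | mul_X p i hp =>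
    rw [map_mul, hp]
    ext
    · simp
    · simp only [TrivSqZeroExt.snd_mul, TrivSqZeroExt.snd_add, TrivSqZeroExt.fst_add,
        TrivSqZeroExt.fst_inl, TrivSqZeroExt.snd_inl, TrivSqZeroExt.fst_inr,
        TrivSqZeroExt.snd_inr, MvPolynomial.aeval_X, Derivation.leibniz, MvPolynomial.pderiv_X,
        smul_eq_mul, map_add, map_mul, MvPolynomial.eval_X, op_smul_eq_smul, add_mul,
        Finset.sum_add_distrib, zero_mul, zero_add, add_zero]
      congr 1
      · simp [Pi.single_apply, apply_ite]
      · rw [Finset.mul_sum]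
        exact Finset.sum_congr rfl fun j _ => by ring

open TrivSqZeroExt in
/-- A point `φ` over the dual numbers whose reduction is a rational point of a basic open subset
`Spec B` of `Spec A` comes from a derivation of `B`. -/
theorem exists_derivation_of_dualNumber {K A B : Type*} [Field K] [CommRing A] [CommRing B]
    [Algebra K A] [Algebra K B] [Algebra A B] [IsScalarTower K A B] [Algebra B K]
    [IsScalarTower K B K] (f : A) [IsLocalization.Away f B]
    (φ : A →ₐ[K] TrivSqZeroExt K K)
    (hε : ∀ y, (φ y).fst = algebraMap B K (algebraMap A B y)) :
    ∃ d : Derivation K B K, ∀ y, d (algebraMap A B y) = (φ y).snd := by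
  have hu : ∀ y : Submonoid.powers f, IsUnit (φ y) := fun y => by
    rw [TrivSqZeroExt.isUnit_iff_isUnit_fst, hε]
    exact (IsLocalization.map_units B y).map _
  let φB : B →ₐ[K] TrivSqZeroExt K K :=
    IsLocalization.liftAlgHom (M := Submonoid.powers f) (f := φ) hu
  have hφB : ∀ y, φB (algebraMap A B y) = φ y := fun y => IsLocalization.lift_eq hu y
  have hfst : ∀ y, (φB y).fst = algebraMap B K y := by
    have : ((TrivSqZeroExt.fstHom K K K).comp φB : B →+* K) = algebraMap B K := by
      refine IsLocalization.ringHom_ext (Submonoid.powers f) ?_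
      ext y
      simpa [hφB] using hε y
    exact fun y => DFunLike.congr_fun this y
  refine ⟨Derivation.mk' ((TrivSqZeroExt.sndHom K K).comp φB.toLinearMap) fun y z => ?_,
    fun y => congrArg TrivSqZeroExt.snd (hφB y)⟩
  change (φB (y * z)).snd = y • (φB z).snd + z • (φB y).snd
  rw [map_mul, TrivSqZeroExt.snd_mul, hfst, hfst, op_smul_eq_smul, algebraMap_smul,
    algebraMap_smul]

/-- Tangent vectors are points over the dual numbers, and these are the derivations of a smooth
neighbourhood of the point. Hence the tangent space is no larger than the Krull dimension. -/
theorem finrank_tangentSpace_le {K : Type u} [Field K] {τ : Type} [Fintype τ]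
    (I : Ideal (MvPolynomial τ K)) (D : MvPolynomial τ K) (x : τ → K)
    (hI : ∀ f ∈ I, MvPolynomial.eval x f = 0) (hD : MvPolynomial.eval x D ≠ 0)
    [Algebra.Smooth K (Localization.Away (Ideal.Quotient.mk I D))] :
    (Module.finrank K (tangentSpace I x) : WithBot ℕ∞) ≤
      ringKrullDim (Localization.Away (Ideal.Quotient.mk I D)) := by
  let A := Localization.Away (Ideal.Quotient.mk I D)
  let a : MvPolynomial τ K →ₐ[K] A := (IsScalarTower.toAlgHom K _ A).comp (Ideal.Quotient.mkₐ K I)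
  have lift : ∀ (S : Type u) [CommRing S] [Algebra K S] (ψ : MvPolynomial τ K →ₐ[K] S)
      (_ : ∀ f ∈ I, ψ f = 0) (_ : IsUnit (ψ D)), ∃ φ : A →ₐ[K] S, φ.comp a = ψ := by
    intro S _ _ ψ h0 hu
    have hmk : ∀ g, Ideal.Quotient.liftₐ I ψ h0 (Ideal.Quotient.mk I g) = ψ g := fun g => rfl
    have hu' : ∀ y : Submonoid.powers (Ideal.Quotient.mk I D),
        IsUnit (Ideal.Quotient.liftₐ I ψ h0 y) := by
      rintro ⟨_, k, rfl⟩
      simpa only [map_pow, hmk] using hu.pow k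
    refine ⟨IsLocalization.liftAlgHom (M := Submonoid.powers (Ideal.Quotient.mk I D))
      (f := Ideal.Quotient.liftₐ I ψ h0) hu', ?_⟩
    ext i
    exact (IsLocalization.lift_eq hu' _).trans (hmk _)
  have ext : ∀ (S : Type u) [CommRing S] [Algebra K S] (φ φ' : A →ₐ[K] S),
      φ.comp a = φ'.comp a → φ = φ' := by
    intro S _ _ φ φ' h
    refine IsLocalization.algHom_ext (Submonoid.powers (Ideal.Quotient.mk I D)) ?_
    refine Ideal.Quotient.algHom_ext _ ?_
    exact h
  obtain ⟨ε, hε⟩ := lift K (MvPolynomial.aeval x)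
    (fun f hf => by simpa [MvPolynomial.aeval_eq_eval] using hI f hf)
    (by simpa [MvPolynomial.aeval_eq_eval] using hD)
  have hp : (RingHom.ker ε).IsPrime := RingHom.ker_isPrime _
  obtain ⟨f, hf, hsm⟩ :=
    Algebra.IsSmoothAt.exists_notMem_isStandardSmooth K (RingHom.ker ε)
  have hf0 : ε f ≠ 0 := hf
  let B := Localization.Away f
  have hεu : ∀ y : Submonoid.powers f, IsUnit (ε y) := by
    rintro ⟨_, k, rfl⟩
    simpa only [map_pow] using (isUnit_iff_ne_zero.2 hf0).pow k
  let εB : B →ₐ[K] K := IsLocalization.liftAlgHom (M := Submonoid.powers f) (f := ε) hεu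
  let _ : Algebra B K := εB.toRingHom.toAlgebra
  have : IsScalarTower K B K := IsScalarTower.of_algebraMap_eq fun c => (εB.commutes c).symm
  obtain ⟨hfin, hrank⟩ := finrank_derivation_le_ringKrullDim (K := K) (B := B)
  refine le_trans ?_ (hrank.trans (ringKrullDim_localization_le (Submonoid.powers f) B))
  let ev : Derivation K B K →ₗ[K] (τ → K) :=
    { toFun := fun d i => d (algebraMap A B (a (MvPolynomial.X i)))
      map_add' := fun _ _ => rfl
      map_smul' := fun _ _ => rfl }
  have hle : tangentSpace I x ≤ LinearMap.range ev := by
    intro v hv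
    obtain ⟨φ, hφ⟩ := lift (TrivSqZeroExt K K)
      (MvPolynomial.aeval fun i => (TrivSqZeroExt.inl (x i) + TrivSqZeroExt.inr (v i)))
      (fun g hg => by rw [aeval_inl_add_inr, hI g hg, hv g hg]; simp)
      (by rw [aeval_inl_add_inr, TrivSqZeroExt.isUnit_iff_isUnit_fst]; simpa using hD)
    have hfst : (TrivSqZeroExt.fstHom K K K).comp φ = ε := by
      apply ext
      rw [AlgHom.comp_assoc, hφ, hε]
      ext i
      simp
    obtain ⟨d, hd⟩ := exists_derivation_of_dualNumber (B := B) f φ fun y =>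
      (DFunLike.congr_fun hfst y).trans (IsLocalization.lift_eq hεu y).symm
    refine ⟨d, funext fun i => (hd _).trans ?_⟩
    have h2 : φ (a (MvPolynomial.X i)) = _ := DFunLike.congr_fun hφ (MvPolynomial.X i)
    simp [h2]
  have := (Submodule.finrank_mono hle).trans (LinearMap.finrank_range_le ev)
  exact_mod_cast this

/-! ### Integral points near a rational point -/

/-- The common zero space of the differentials at `x` of the elements of `I` is the tangent space.
If `δ` further linear forms `L` have no common zero on it, then by duality every coordinate is the
sum of such a differential and a combination of the forms in `L`. -/
theorem exists_linearForms_of_finrank_tangentSpace_le {K : Type u} [Field K] {τ : Type v}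
    [Fintype τ] (I : Ideal (MvPolynomial τ K)) (x : τ → K) {δ : ℕ}
    (hδ : Module.finrank K (tangentSpace I x) ≤ δ) :
    ∃ (f : τ → MvPolynomial τ K) (b : τ → Fin δ → K) (L : Fin δ → τ → K), (∀ j, f j ∈ I) ∧
      ∀ (y : τ → K) j, y j = ∑ i, MvPolynomial.eval x (MvPolynomial.pderiv i (f j)) * y i +
        ∑ t, b j t * ∑ i, L t i * y i := by
  classical
  let T := tangentSpace I x
  let g : T →ₗ[K] (Fin δ → K) :=
    (Function.ExtendByZero.linearMap K (Fin.castLE hδ)).comp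
      (Module.finBasis K T).equivFun.toLinearMap
  have hg : Function.Injective g :=
    (Function.extend_injective (Fin.castLE_injective hδ) _).comp
      (Module.finBasis K T).equivFun.injective
  obtain ⟨L, hL⟩ := LinearMap.exists_extend g
  let dI : MvPolynomial τ K →ₗ[K] Module.Dual K (τ → K) :=
    { toFun := fun f => ∑ i, MvPolynomial.eval x (MvPolynomial.pderiv i f) • LinearMap.proj i
      map_add' := fun f f' => by simp [add_smul, Finset.sum_add_distrib]
      map_smul' := fun c f => by simp [mul_smul, Finset.smul_sum] }
  have hdI : ∀ f y, dI f y = ∑ i, MvPolynomial.eval x (MvPolynomial.pderiv i f) * y i :=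
    fun f y => by simp [dI]
  let l : Fin δ → Module.Dual K (τ → K) := fun t => (LinearMap.proj t).comp L
  let Φ : Submodule K (Module.Dual K (τ → K)) :=
    (I.restrictScalars K).map dI ⊔ Submodule.span K (Set.range l)
  have hΦ : Φ = ⊤ := by
    by_contra hne
    obtain ⟨F, hF0, hF⟩ := Submodule.exists_le_ker_of_lt_top Φ (lt_top_iff_ne_top.2 hne)
    obtain ⟨v, rfl⟩ := (Module.evalEquiv K (τ → K)).surjective F
    have hv : ∀ ψ ∈ Φ, ψ v = 0 := fun ψ hψ => hF hψ
    have hvT : v ∈ T := fun f hf => by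
      rw [← hdI]
      exact hv _ (Submodule.mem_sup_left ⟨f, hf, rfl⟩)
    have hLv : L v = 0 := funext fun t =>
      hv (l t) (Submodule.mem_sup_right (Submodule.subset_span ⟨t, rfl⟩))
    have : g ⟨v, hvT⟩ = g 0 := by
      rw [map_zero, ← hL]
      exact hLv
    have hv0 : v = 0 := congrArg Subtype.val (hg this)
    exact hF0 (by rw [hv0, map_zero])
  have hex : ∀ j : τ, ∃ (f : MvPolynomial τ K) (b : Fin δ → K), f ∈ I ∧
      ∀ y : τ → K, y j = ∑ i, MvPolynomial.eval x (MvPolynomial.pderiv i f) * y i +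
        ∑ t, b t * L y t := by
    intro j
    have hj : (LinearMap.proj j : Module.Dual K (τ → K)) ∈ Φ := by rw [hΦ]; trivial
    obtain ⟨_, ⟨f, hf, rfl⟩, w, hw, hsum⟩ := Submodule.mem_sup.1 hj
    obtain ⟨b, rfl⟩ := (Submodule.mem_span_range_iff_exists_fun K).1 hw
    refine ⟨f, b, hf, fun y => ?_⟩
    have := LinearMap.congr_fun hsum y
    simpa [hdI, l] using this.symm
  choose f b hf hy using hex
  refine ⟨f, b, fun t i => L (fun j => if i = j then 1 else 0) t, hf, fun y j => ?_⟩
  rw [hy j y]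
  congr 1
  refine Finset.sum_congr rfl fun t _ => ?_
  congr 1
  rw [LinearMap.pi_apply_eq_sum_univ L y]
  simp [mul_comm]

theorem MvPolynomial.exists_map_eq_C_mul {O K τ : Type*} [CommRing O] [Field K] [Algebra O K]
    (f : MvPolynomial τ K) (a : O)
    (h : ∀ m ∈ f.support, IsLocalization.IsInteger O (a • f.coeff m)) :
    ∃ F : MvPolynomial τ O, F.map (algebraMap O K) = C (algebraMap O K a) * f := by
  choose! c hc using h
  refine ⟨∑ m ∈ f.support, monomial m (c m), ?_⟩
  conv_rhs => rw [f.as_sum]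
  rw [map_sum, Finset.mul_sum]
  refine Finset.sum_congr rfl fun m hm => ?_
  rw [map_monomial, hc m hm, C_mul_monomial, Algebra.smul_def]

/-- The integral form of `exists_linearForms_of_finrank_tangentSpace_le`, obtained by clearing
denominators. -/
theorem exists_integral_linearForms {O : Type*} {K : Type u} [CommRing O] [IsDomain O] [Field K]
    [Algebra O K] [IsFractionRing O K] {τ : Type v} [Fintype τ] (I : Ideal (MvPolynomial τ K))
    (x : τ → O) {δ : ℕ}
    (hδ : Module.finrank K (tangentSpace I fun i => algebraMap O K (x i)) ≤ δ) :
    ∃ (a : O) (F : τ → MvPolynomial τ O) (b : τ → Fin δ → O) (L : Fin δ → τ → O), a ≠ 0 ∧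
      (∀ j, (F j).map (algebraMap O K) ∈ I) ∧
      ∀ (y : τ → O) j, a * y j =
        ∑ i, MvPolynomial.eval x (MvPolynomial.pderiv i (F j)) * y i +
          ∑ t, b j t * ∑ i, L t i * y i := by
  classical
  obtain ⟨f, b, L, hf, h⟩ := exists_linearForms_of_finrank_tangentSpace_le I _ hδ
  obtain ⟨⟨a, ha⟩, hint⟩ := IsLocalization.exist_integer_multiples_of_finset (nonZeroDivisors O)
    ((Finset.univ.biUnion fun j => (f j).support.image fun m => (f j).coeff m) ∪
      ((Finset.univ.image fun p : τ × Fin δ => b p.1 p.2) ∪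
        (Finset.univ.image fun p : Fin δ × τ => L p.1 p.2)))
  have hF : ∀ j, ∃ F : MvPolynomial τ O, F.map (algebraMap O K) =
      MvPolynomial.C (algebraMap O K a) * f j := fun j =>
    MvPolynomial.exists_map_eq_C_mul _ _ fun m hm => hint _ <| Finset.mem_union_left _ <|
      Finset.mem_biUnion.2 ⟨j, Finset.mem_univ _, Finset.mem_image_of_mem _ hm⟩
  have hb : ∀ j t, IsLocalization.IsInteger O (a • b j t) := fun j t => hint _ <|
    Finset.mem_union_right _ <| Finset.mem_union_left _ <|
      Finset.mem_image.2 ⟨(j, t), Finset.mem_univ _, rfl⟩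
  have hL : ∀ t i, IsLocalization.IsInteger O (a • L t i) := fun t i => hint _ <|
    Finset.mem_union_right _ <| Finset.mem_union_right _ <|
      Finset.mem_image.2 ⟨(t, i), Finset.mem_univ _, rfl⟩
  choose F hF using hF
  choose b' hb' using hb
  choose L' hL' using hL
  refine ⟨a * a, fun j => MvPolynomial.C a * F j, b', L',
    mul_ne_zero (nonZeroDivisors.ne_zero ha) (nonZeroDivisors.ne_zero ha), fun j => ?_,
    fun y j => ?_⟩
  · rw [map_mul, hF]
    exact I.mul_mem_left _ (I.mul_mem_left _ (hf j))
  · apply IsFractionRing.injective O K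
    have hd : ∀ i, algebraMap O K (MvPolynomial.eval x (MvPolynomial.pderiv i (F j))) =
        algebraMap O K a * MvPolynomial.eval (fun i => algebraMap O K (x i))
          (MvPolynomial.pderiv i (f j)) := by
      intro i
      have h1 := congrArg (fun p => MvPolynomial.eval (fun i => algebraMap O K (x i))
        (MvPolynomial.pderiv i p)) (hF j)
      simp only [MvPolynomial.pderiv_map, MvPolynomial.pderiv_C_mul, map_mul, MvPolynomial.eval_C]
        at h1
      rw [← h1, MvPolynomial.eval_map, MvPolynomial.eval₂_comp]
      rfl
    have h2 := h (fun i => algebraMap O K (y i)) j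
    simp only [MvPolynomial.pderiv_C_mul, map_add, map_mul, map_sum, hd, hb', hL',
      Algebra.smul_def, MvPolynomial.eval_C]
    rw [h2, mul_add, Finset.mul_sum, Finset.mul_sum]
    congr 1
    · exact Finset.sum_congr rfl fun i _ => by ring
    · refine Finset.sum_congr rfl fun t _ => ?_
      simp only [Finset.mul_sum]
      exact Finset.sum_congr rfl fun i _ => by ring

/-- First order Taylor expansion: if `g` and `h` agree with `e` modulo `J` and with each other
modulo `Q`, then `F g - F h` agrees with the differential of `F` at `e` modulo `J * Q`. -/
theorem MvPolynomial.eval_sub_eval_sub_pderiv_mem {O τ : Type*} [CommRing O] [Fintype τ]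
    (J Q : Ideal O) (F : MvPolynomial τ O) {e g h : τ → O} (hg : ∀ i, g i - e i ∈ J)
    (hh : ∀ i, h i - e i ∈ J) (hgh : ∀ i, g i - h i ∈ Q) :
    eval g F - eval h F - ∑ i, eval e (pderiv i F) * (g i - h i) ∈ J * Q := by
  classical
  have cong : ∀ (I : Ideal O) (p : MvPolynomial τ O) {u w : τ → O}, (∀ i, u i - w i ∈ I) →
      eval u p - eval w p ∈ I := by
    intro I p u w huw
    rw [← Ideal.Quotient.eq, eval₂_comp (Ideal.Quotient.mk I) u p,
      eval₂_comp (Ideal.Quotient.mk I) w p]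
    exact congrArg (fun z => eval₂ _ z p) (_root_.funext fun i => Ideal.Quotient.eq.2 (huw i))
  induction F using MvPolynomial.induction_on with
  | C a => simp
  | add p q hp hq =>
    convert! (J * Q).add_mem hp hq using 1
    simp only [map_add, add_mul, Finset.sum_add_distrib]
    ring
  | mul_X p k hp =>
    have h1 := (J * Q).mul_mem_left (e k) hp
    have h2 := Ideal.mul_mem_mul (hg k) (cong Q p hgh)
    have h3 := Ideal.mul_mem_mul (cong J p hh) (hgh k)
    convert! (J * Q).add_mem ((J * Q).add_mem h1 h2) h3 using 1
    have : ∑ i, eval e (pderiv i (p * X k)) * (g i - h i) =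
        e k * ∑ i, eval e (pderiv i p) * (g i - h i) + eval e p * (g k - h k) := by
      simp only [Derivation.leibniz, pderiv_X, smul_eq_mul, map_add, map_mul, eval_X, add_mul,
        Finset.sum_add_distrib, Finset.mul_sum]
      rw [add_comm]
      congr 1
      · exact Finset.sum_congr rfl fun i _ => by ring
      · simp [Pi.single_apply, apply_ite]
    rw [this]
    simp only [map_mul, eval_X]
    ring

open IsLocalRing in
theorem mem_maximalIdeal_pow_of_mul_mem {O : Type*} [CommRing O] [IsDomain O]
    [IsDiscreteValuationRing O] {a x : O} {m j : ℕ} (ha : a ∉ maximalIdeal O ^ m)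
    (hax : a * x ∈ maximalIdeal O ^ (j + m)) : x ∈ maximalIdeal O ^ (j + 1) := by
  obtain ⟨π, hπ⟩ := IsDiscreteValuationRing.exists_irreducible O
  rw [hπ.maximalIdeal_eq, Ideal.span_singleton_pow, Ideal.mem_span_singleton] at *
  by_cases hx0 : x = 0
  · simp [hx0]
  have ha0 : a ≠ 0 := fun h => ha (by simp [h])
  obtain ⟨c, u, rfl⟩ := IsDiscreteValuationRing.eq_unit_mul_pow_irreducible ha0 hπ
  obtain ⟨d, w, rfl⟩ := IsDiscreteValuationRing.eq_unit_mul_pow_irreducible hx0 hπ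
  have hinj : ∀ {s t : ℕ}, π ^ s ∣ π ^ t ↔ s ≤ t := pow_dvd_pow_iff hπ.ne_zero hπ.not_isUnit
  have h1 : (u : O) * π ^ c * (w * π ^ d) = ((u * w : Oˣ) : O) * π ^ (c + d) := by
    push_cast; ring
  rw [h1, Units.dvd_mul_left, hinj] at hax
  rw [Units.dvd_mul_left, hinj] at ha ⊢
  omega

open IsLocalRing in
/-- On the integral points of a scheme that are close to `x`, reduction of `δ` suitable integral
linear forms modulo `𝔪 ^ (k + m)` determines the reduction of the point modulo `𝔪 ^ k`, where `δ` is
at least the dimension of the tangent space at `x` and `m` does not depend on `k`. -/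
theorem exists_linearForms_separating_points {O : Type*} {K : Type u} [CommRing O] [IsDomain O]
    [IsDiscreteValuationRing O] [Field K]
    [Algebra O K] [IsFractionRing O K] {τ : Type v} [Fintype τ] (I : Ideal (MvPolynomial τ K))
    (x : τ → O) {δ : ℕ}
    (hδ : Module.finrank K (tangentSpace I fun i => algebraMap O K (x i)) ≤ δ) :
    ∃ (m : ℕ) (L : Fin δ → τ → O), ∀ (k : ℕ) (g h : τ → O),
      (∀ f ∈ I, MvPolynomial.eval (fun i => algebraMap O K (g i)) f = 0) →
      (∀ f ∈ I, MvPolynomial.eval (fun i => algebraMap O K (h i)) f = 0) →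
      (∀ i, g i - x i ∈ maximalIdeal O ^ m) → (∀ i, h i - x i ∈ maximalIdeal O ^ m) →
      (∀ t, ∑ i, L t i * (g i - h i) ∈ maximalIdeal O ^ (k + m)) →
      ∀ i, g i - h i ∈ maximalIdeal O ^ k := by
  obtain ⟨a, F, b, L, ha, hF, hy⟩ := exists_integral_linearForms I x hδ
  obtain ⟨m, hm⟩ : ∃ m, a ∉ maximalIdeal O ^ m := by
    by_contra! hall
    have : a ∈ ⨅ i : ℕ, maximalIdeal O ^ i := Ideal.mem_iInf.2 hall
    rw [Ideal.iInf_pow_eq_bot_of_isLocalRing _ (maximalIdeal.isMaximal O).ne_top] at this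
    exact ha this
  refine ⟨m, L, fun k g h hgI hhI hg hh hL => ?_⟩
  have hFz : ∀ j (z : τ → O), (∀ f ∈ I, MvPolynomial.eval (fun i => algebraMap O K (z i)) f = 0) →
      MvPolynomial.eval z (F j) = 0 := by
    intro j z hz
    apply IsFractionRing.injective O K
    rw [map_zero, ← hz _ (hF j), MvPolynomial.eval_map, MvPolynomial.eval₂_comp]
    rfl
  -- the congruence between `g` and `h` improves by one step at a time
  have step : ∀ j ≤ k, ∀ i, g i - h i ∈ maximalIdeal O ^ j := by
    intro j
    induction j with
    | zero => simp
    | succ j ih =>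
      intro hj i
      refine mem_maximalIdeal_pow_of_mul_mem hm ?_
      rw [hy (fun i => g i - h i) i]
      refine Ideal.add_mem _ ?_ (Ideal.sum_mem _ fun t _ => Ideal.mul_mem_left _ _
        (Ideal.pow_le_pow_right (by omega) (hL t)))
      have := MvPolynomial.eval_sub_eval_sub_pderiv_mem (maximalIdeal O ^ m) (maximalIdeal O ^ j)
        (F i) hg hh (ih (by omega))
      rw [hFz i g hgI, hFz i h hhI, sub_zero, zero_sub, neg_mem_iff, ← pow_add,
        add_comm m j] at this
      exact this
  exact step k le_rfl

/-! ### The orders of the congruence quotients -/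

/-- The tangent space at the identity has dimension at most `dim G`. -/
theorem LinearAlgebraicGroup.finrank_tangentSpace_one_le {K : Type u} [Field K] {n : ℕ}
    (G : LinearAlgebraicGroup K n) :
    (Module.finrank K (tangentSpace G.ideal fun p => (1 : Matrix (Fin n) (Fin n) K) p.1 p.2) :
      WithBot ℕ∞) ≤ G.dim := by
  have := G.smooth
  refine finrank_tangentSpace_le G.ideal _ _ (fun f hf => ?_) ?_
  · simpa [MvPolynomial.aeval_eq_eval] using G.one_mem K f hf
  · have : MvPolynomial.eval (fun p : Fin n × Fin n => (1 : Matrix (Fin n) (Fin n) K) p.1 p.2)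
        (Matrix.mvPolynomialX (Fin n) (Fin n) K).det = 1 := by
      rw [RingHom.map_det, RingHom.mapMatrix_apply]
      have h1 := Matrix.mvPolynomialX_map_eval₂ (RingHom.id K) (1 : Matrix (Fin n) (Fin n) K)
      change ((Matrix.mvPolynomialX (Fin n) (Fin n) K).map _).det = 1
      rw [show (Matrix.mvPolynomialX (Fin n) (Fin n) K).map (MvPolynomial.eval fun p : Fin n × Fin n
        => (1 : Matrix (Fin n) (Fin n) K) p.1 p.2) = 1 from h1, Matrix.det_one]
    rw [this]
    exact one_ne_zero

section LocalField

variable {K : Type u} [Field K] [ValuativeRel K] [TopologicalSpace K]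
  [IsNonarchimedeanLocalField K]

theorem finite_quotient_maximalIdeal_pow (k : ℕ) : Finite (𝒪[K] ⧸ 𝓂[K] ^ k) :=
  have : Finite (𝒪[K] ⧸ 𝓂[K]) := inferInstanceAs (Finite 𝓀[K])
  Ideal.finite_quotient_pow (IsNoetherian.noetherian _) k

theorem card_quotient_maximalIdeal_pow (k : ℕ) :
    Nat.card (𝒪[K] ⧸ 𝓂[K] ^ k) = Nat.card 𝓀[K] ^ k := by
  have := cardQuot_pow_of_prime (P := 𝓂[K])
    (IsDiscreteValuationRing.not_a_field 𝒪[K]) (i := k)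
  rw [Submodule.cardQuot_apply, Submodule.cardQuot_apply] at this
  exact this

theorem mk_congruenceSubgroup_eq_iff {n : ℕ} (U : Subgroup (GL (Fin n) 𝒪[K])) (k : ℕ) (g h : U) :
    (g : U ⧸ congruenceSubgroup U k) = h ↔
      ∀ i j, (g : GL (Fin n) 𝒪[K]) i j - (h : GL (Fin n) 𝒪[K]) i j ∈ 𝓂[K] ^ k := by
  rw [eq_comm, QuotientGroup.eq, congruenceSubgroup, MonoidHom.mem_ker, map_mul, map_inv,
    inv_mul_eq_one, eq_comm, Units.ext_iff, ← Matrix.ext_iff]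
  exact forall₂_congr fun i j => Ideal.Quotient.eq

theorem finite_quotient_congruenceSubgroup {n : ℕ} (U : Subgroup (GL (Fin n) 𝒪[K])) (k : ℕ) :
    Finite (U ⧸ congruenceSubgroup U k) := by
  have := finite_quotient_maximalIdeal_pow (K := K) k
  have : Finite (GL (Fin n) (𝒪[K] ⧸ 𝓂[K] ^ k)) :=
    inferInstanceAs (Finite (Matrix (Fin n) (Fin n) (𝒪[K] ⧸ 𝓂[K] ^ k))ˣ)
  exact Finite.of_equiv _ (QuotientGroup.quotientKerEquivRange _).toEquiv.symm

theorem isLocallyConstant_mk_congruenceSubgroup {n : ℕ} (U : Subgroup (GL (Fin n) 𝒪[K])) (k : ℕ) :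
    IsLocallyConstant (QuotientGroup.mk' (congruenceSubgroup U k)) := by
  rw [IsLocallyConstant.iff_eventually_eq]
  intro g
  simp only [QuotientGroup.mk'_apply, mk_congruenceSubgroup_eq_iff, Filter.eventually_all]
  intro i j
  have : T2Space K := by
    let := IsTopologicalAddGroup.rightUniformSpace K
    have := isUniformAddGroup_of_addCommGroup (G := K)
    infer_instance
  have hc : Continuous fun h : U =>
      (h : GL (Fin n) 𝒪[K]) i j - (g : GL (Fin n) 𝒪[K]) i j := by
    have : Continuous fun h : U => ((h : GL (Fin n) 𝒪[K]) : Matrix (Fin n) (Fin n) 𝒪[K]) :=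
      Units.continuous_val.comp continuous_subtype_val
    exact (this.matrix_elem i j).sub continuous_const
  refine hc.continuousAt.eventually_mem ((IsLocalRing.isOpen_maximalIdeal_pow 𝒪[K] k).mem_nhds ?_)
  simp

/-- The order of `U / U_k` is at most a constant multiple of `q ^ (δ k)`: on a fixed congruence
subgroup, `δ` linear forms in the matrix entries separate the cosets of `U_k`. -/
theorem exists_card_quotient_congruenceSubgroup_le {n : ℕ} (G : LinearAlgebraicGroup K n) {δ : ℕ}
    (hδ : G.dim = (δ : WithBot ℕ∞)) (U : Subgroup (GL (Fin n) 𝒪[K])) (hU : U ≤ G.integralPoints) :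
    ∃ C : ℕ, ∀ k, Nat.card (U ⧸ congruenceSubgroup U k) ≤ C * (Nat.card 𝓀[K] ^ k) ^ δ := by
  have hT := G.finrank_tangentSpace_one_le
  rw [hδ] at hT
  have hx : (fun p : Fin n × Fin n => (1 : Matrix (Fin n) (Fin n) K) p.1 p.2) =
      fun p => algebraMap 𝒪[K] K ((1 : Matrix (Fin n) (Fin n) 𝒪[K]) p.1 p.2) := by
    ext p
    simp [Matrix.one_apply, apply_ite]
  rw [hx] at hT
  obtain ⟨m, L, hL⟩ :=
    exists_linearForms_separating_points G.ideal _ (δ := δ) (by exact_mod_cast hT)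
  have hz : ∀ g : U, ∀ f ∈ G.ideal, MvPolynomial.eval (fun p : Fin n × Fin n =>
      algebraMap 𝒪[K] K ((g : GL (Fin n) 𝒪[K]) p.1 p.2)) f = 0 := by
    intro g f hf
    have := hU g.2 f hf
    rw [MvPolynomial.aeval_eq_eval] at this
    exact this
  let ℓ : U → Fin δ → 𝒪[K] := fun g t => ∑ p, L t p * (g : GL (Fin n) 𝒪[K]) p.1 p.2
  refine ⟨Nat.card (U ⧸ congruenceSubgroup U m) * (Nat.card 𝓀[K] ^ m) ^ δ, fun k => ?_⟩
  let s : U → U := fun g => (g : U ⧸ congruenceSubgroup U m).out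
  let Ψ : U ⧸ congruenceSubgroup U k →
      (U ⧸ congruenceSubgroup U m) × (Fin δ → 𝒪[K] ⧸ 𝓂[K] ^ (k + m)) := fun c =>
    (c.out, fun t => Ideal.Quotient.mk _ (ℓ ((s c.out)⁻¹ * c.out) t))
  have hs : ∀ g : U, ∀ p : Fin n × Fin n, (((s g)⁻¹ * g : U) : GL (Fin n) 𝒪[K]) p.1 p.2 -
      (1 : Matrix (Fin n) (Fin n) 𝒪[K]) p.1 p.2 ∈ 𝓂[K] ^ m := by
    intro g p
    refine (mk_congruenceSubgroup_eq_iff U m ((s g)⁻¹ * g) 1).1 ?_ p.1 p.2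
    rw [QuotientGroup.mk_mul, QuotientGroup.mk_inv, QuotientGroup.out_eq', inv_mul_cancel,
      QuotientGroup.mk_one]
  have hΨ : Function.Injective Ψ := by
    intro c c' h
    have h1 : s c.out = s c'.out := congrArg Quotient.out (congrArg Prod.fst h)
    have h2 : ∀ p : Fin n × Fin n, (((s c.out)⁻¹ * c.out : U) : GL (Fin n) 𝒪[K]) p.1 p.2 -
        (((s c'.out)⁻¹ * c'.out : U) : GL (Fin n) 𝒪[K]) p.1 p.2 ∈ 𝓂[K] ^ k := by
      refine hL k _ _ (hz _) (hz _) (hs _) (hs _) fun t => ?_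
      have h3 := Ideal.Quotient.eq.1 (congrFun (congrArg Prod.snd h) t)
      simpa only [ℓ, ← Finset.sum_sub_distrib, ← mul_sub] using h3
    have h4 := (mk_congruenceSubgroup_eq_iff U k _ _).2 fun i j => h2 (i, j)
    rw [← h1, QuotientGroup.mk_mul, QuotientGroup.mk_mul, mul_left_cancel_iff,
      QuotientGroup.out_eq', QuotientGroup.out_eq'] at h4
    exact h4
  have := finite_quotient_maximalIdeal_pow (K := K) (k + m)
  have := finite_quotient_congruenceSubgroup U m
  refine (Nat.card_le_card_of_injective Ψ hΨ).trans (le_of_eq ?_)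
  rw [Nat.card_prod, Nat.card_fun, card_quotient_maximalIdeal_pow, Nat.card_fin, pow_add, mul_pow]
  ring

end LocalField

/-! ### Asymptotics -/

open Filter in
theorem limsup_ofReal_logb_div_le {q : ℝ} (hq : 1 < q) {C δ : ℕ} {c : ℕ → ℕ} (hC : 0 < C)
    (hc : ∀ k, 0 < c k)
    (hcC : ∀ k, (c k : ℝ) ≤ C * (q ^ k) ^ δ) :
    limsup (fun k : ℕ => ENNReal.ofReal (Real.logb q (c k) / k)) atTop ≤ (δ : ℝ≥0∞) := by
  have hq0 : 0 < q := by linarith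
  have hC' : (0 : ℝ) < C := by exact_mod_cast hC
  have hlim : Tendsto (fun k : ℕ => ENNReal.ofReal (Real.logb q C / k + δ)) atTop
      (nhds (δ : ℝ≥0∞)) := by
    have := (tendsto_const_div_atTop_nhds_zero_nat (Real.logb q C)).add_const (δ : ℝ)
    rw [zero_add] at this
    simpa using ENNReal.tendsto_ofReal this
  rw [← hlim.limsup_eq]
  refine limsup_le_limsup ?_
  filter_upwards [eventually_gt_atTop 0] with k hk
  have hk' : (0 : ℝ) < k := by exact_mod_cast hk
  refine ENNReal.ofReal_le_ofReal ?_
  rw [div_le_iff₀ hk', add_mul, div_mul_cancel₀ _ hk'.ne']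
  have h1 := Real.logb_le_logb_of_le hq (by exact_mod_cast hc k) (hcC k)
  rw [Real.logb_mul hC'.ne' (by positivity), Real.logb_pow, Real.logb_pow,
    Real.logb_self_eq_one hq] at h1
  linarith

/-- If for every `k` the numbers `R N` satisfy `c k - h k / (N + 1) ^ 2 ≤ R N`, where
`h k ≤ C q ^ (δ k)` and `q ^ (γ k) ≤ c k` for infinitely many `k`, then `R N ≥ N ^ z` infinitely
often for each `z < 2 γ / (δ - γ)`. -/
theorem le_limsup_log_div_log {q : ℝ} (hq : 1 < q) {C δ : ℕ} {c h : ℕ → ℕ} {R : ℕ → ℕ∞}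
    (hC : 0 < C) (hh : ∀ k, (h k : ℝ) ≤ C * (q ^ k) ^ δ)
    (hR : ∀ k N, ∃ s : ℕ, (s : ℕ∞) ≤ R N ∧ c k * (N + 1) ^ 2 ≤ s * (N + 1) ^ 2 + h k)
    {γ z : ℝ} (hγδ : γ < δ) (hz : 0 < z) (hzγ : z * (δ - γ) < 2 * γ)
    (hγ : ∃ᶠ k : ℕ in Filter.atTop, q ^ (γ * k) ≤ (c k : ℝ)) :
    (z : EReal) ≤ Filter.limsup
      (fun N : ℕ => ENNReal.log ((R N : ℕ∞) : ℝ≥0∞) / ((Real.log (N : ℝ) : ℝ) : EReal))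
      Filter.atTop := by
  have hq0 : 0 < q := by linarith
  have hlq : 0 < Real.log q := Real.log_pos hq
  have hC' : (0 : ℝ) < C := by exact_mod_cast hC
  -- for `N` at least `X k`, the term `h k / (N + 1) ^ 2` is at most half of `q ^ (γ k)`
  let X : ℕ → ℝ := fun k => Real.sqrt (2 * C) * q ^ ((δ - γ) / 2 * k)
  have hX0 : ∀ k, 0 < X k := fun k => by positivity
  have hlogX : ∀ k, Real.log (X k) = Real.log (Real.sqrt (2 * C)) +
      (δ - γ) / 2 * k * Real.log q := fun k => by
    rw [Real.log_mul (by positivity) (by positivity), Real.log_rpow hq0]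
  have hX2 : ∀ k, X k ^ 2 * q ^ (γ * k) = 2 * (C * (q ^ k) ^ δ) := fun k => by
    have h1 : (q ^ k) ^ δ = q ^ ((δ : ℝ) * k) := by
      rw [← pow_mul, ← Real.rpow_natCast]
      push_cast
      ring_nf
    have h2 : (q ^ ((δ - γ) / 2 * k)) ^ 2 * q ^ (γ * k) = q ^ ((δ : ℝ) * k) := by
      rw [← Real.rpow_natCast, ← Real.rpow_mul hq0.le, ← Real.rpow_add hq0]
      congr 1
      push_cast
      ring
    rw [mul_pow, Real.sq_sqrt (by positivity), mul_assoc, h2, h1]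
    ring
  have hkt : Filter.Tendsto (fun k : ℕ => (k : ℝ)) Filter.atTop Filter.atTop :=
    tendsto_natCast_atTop_atTop
  have hXt : Filter.Tendsto X Filter.atTop Filter.atTop := by
    refine Filter.Tendsto.const_mul_atTop (by positivity) ?_
    exact (tendsto_rpow_atTop_of_base_gt_one _ hq).comp
      (hkt.const_mul_atTop (by linarith : 0 < (δ - γ) / 2))
  have hNt : Filter.Tendsto (fun k => ⌈X k⌉₊) Filter.atTop Filter.atTop :=
    tendsto_nat_ceil_atTop.comp hXt
  have hlin : ∀ᶠ k : ℕ in Filter.atTop,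
      z * Real.log (2 * X k) ≤ γ * k * Real.log q - Real.log 2 := by
    have hη : 0 < (γ - z * (δ - γ) / 2) * Real.log q := mul_pos (by linarith) hlq
    filter_upwards [(hkt.const_mul_atTop hη).eventually_ge_atTop
      (z * (Real.log 2 + Real.log (Real.sqrt (2 * C))) + Real.log 2)] with k hk
    rw [Real.log_mul two_ne_zero (hX0 k).ne', hlogX]
    linarith
  refine Filter.le_limsup_of_frequently_le' (hNt.frequently ?_)
  refine (hγ.and_eventually (hlin.and (hXt.eventually_ge_atTop 2))).mono ?_
  rintro k ⟨hck, hlk, hX⟩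
  set N := ⌈X k⌉₊
  have hXN : X k ≤ N := Nat.le_ceil _
  have hN2 : (2 : ℝ) ≤ N := hX.trans hXN
  have hNX : (N : ℝ) ≤ 2 * X k := by
    have := Nat.ceil_lt_add_one (hX0 k).le
    change (N : ℝ) < _ at this
    linarith
  obtain ⟨s, hsR, hs⟩ := hR k N
  have hs' : (c k : ℝ) * (N + 1) ^ 2 ≤ s * (N + 1) ^ 2 + h k := by exact_mod_cast hs
  have hqpos : 0 < q ^ (γ * k) := Real.rpow_pos_of_pos hq0 _
  have hsq : q ^ (γ * k) / 2 ≤ s := by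
    have h1 : X k ^ 2 ≤ ((N : ℝ) + 1) ^ 2 := pow_le_pow_left₀ (hX0 k).le (by linarith) 2
    have h2 : (h k : ℝ) ≤ q ^ (γ * k) / 2 * ((N : ℝ) + 1) ^ 2 := by
      have := mul_le_mul_of_nonneg_right h1 hqpos.le
      have := hX2 k
      linarith [hh k]
    have h3 : 0 < ((N : ℝ) + 1) ^ 2 := by positivity
    have h4 := mul_le_mul_of_nonneg_right hck h3.le
    refine le_of_mul_le_mul_right ?_ h3
    linarith
  have hs0 : (0 : ℝ) < s := lt_of_lt_of_le (by positivity) hsq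
  have hlogs : z * Real.log N ≤ Real.log s :=
    calc z * Real.log N ≤ z * Real.log (2 * X k) := by
          gcongr
      _ ≤ γ * k * Real.log q - Real.log 2 := hlk
      _ = Real.log (q ^ (γ * k) / 2) := by
          rw [Real.log_div hqpos.ne' two_ne_zero, Real.log_rpow hq0]
      _ ≤ Real.log s := Real.log_le_log (by positivity) hsq
  have hlogN : 0 < Real.log N := Real.log_pos (by linarith)
  rw [EReal.le_div_iff_mul_le (by exact_mod_cast hlogN) (EReal.coe_ne_top _)]
  have h5 : ENNReal.log (s : ℝ≥0∞) ≤ ENNReal.log ((R N : ℕ∞) : ℝ≥0∞) := by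
    refine ENNReal.log_monotone ?_
    exact_mod_cast ENat.toENNReal_le.2 hsR
  refine le_trans ?_ h5
  have h6 : ENNReal.log (s : ℝ≥0∞) = (Real.log s : EReal) := by
    rw [ENNReal.log_pos_real (by simpa using hs0.ne') (by simp)]
    simp
  rw [h6]
  exact_mod_cast hlogs

theorem zero_le_limsup_log_div_log {c h : ℕ → ℕ} {R : ℕ → ℕ∞} (hc : ∀ k, 0 < c k)
    (hR : ∀ k N, ∃ s : ℕ, (s : ℕ∞) ≤ R N ∧ c k * (N + 1) ^ 2 ≤ s * (N + 1) ^ 2 + h k) :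
    (0 : EReal) ≤ Filter.limsup
      (fun N : ℕ => ENNReal.log ((R N : ℕ∞) : ℝ≥0∞) / ((Real.log (N : ℝ) : ℝ) : EReal))
      Filter.atTop := by
  refine Filter.le_limsup_of_frequently_le' (Filter.Eventually.frequently ?_)
  filter_upwards [Filter.eventually_ge_atTop (h 0)] with N hN
  obtain ⟨s, hsR, hs⟩ := hR 0 N
  have hs1 : 1 ≤ s := by
    by_contra! h0
    obtain rfl : s = 0 := by omega
    have := hc 0
    nlinarith
  refine EReal.div_nonneg ?_ (by exact_mod_cast Real.log_natCast_nonneg N)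
  rw [← ENNReal.log_one]
  refine ENNReal.log_monotone ?_
  have : (1 : ℕ∞) ≤ R N := le_trans (by exact_mod_cast hs1) hsR
  exact_mod_cast ENat.toENNReal_le.2 this

theorem ENNReal.two_mul_div_div_one_sub_div {a b : ℝ≥0∞} (hab : a ≤ b) (hb : b ≠ ∞) :
    2 * (a / b) / (1 - a / b) = 2 * a / (b - a) := by
  rcases eq_or_ne b 0 with rfl | hb0
  · obtain rfl : a = 0 := by simpa using hab
    simp
  · have h1 : 1 - a / b = (b - a) / b := by
      rw [ENNReal.sub_div (fun _ _ => hb0), ENNReal.div_self hb0 hb]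
    rw [h1, ← mul_div_assoc, div_eq_mul_inv (2 * a) b, div_eq_mul_inv (b - a) b,
      ENNReal.mul_div_mul_right _ _ (ENNReal.inv_ne_zero.2 hb) (ENNReal.inv_ne_top.2 hb0)]

/-- In `ℝ≥0∞` one has `a / 0 = ∞` for `a ≠ 0`, and the differences below are not truncated because
`γ(U) ≤ δ`. The group `U = G(K) ∩ GL_n(𝒪)` is allowed. -/
theorem proposition6p5 {K : Type*} [Field K] [ValuativeRel K] [TopologicalSpace K]
    [IsNonarchimedeanLocalField K] {n : ℕ} (G : LinearAlgebraicGroup K n)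
    (hG : G.IsAbsolutelyAlmostSimple) (δ : ℕ) (hδ : G.dim = (δ : WithBot ℕ∞))
    (U : Subgroup (GL (Fin n) 𝒪[K])) (hU : U ≤ G.integralPoints) (hUo : IsOpenInPoints G U) :
    classGrowth U ≤ (δ : ℝ≥0∞) ∧
    ((2 * classGrowth U / ((δ : ℝ≥0∞) - classGrowth U) : ℝ≥0∞) : EReal) ≤ abscissa U ∧
    ((2 * (classGrowth U / (δ : ℝ≥0∞)) / (1 - classGrowth U / (δ : ℝ≥0∞)) : ℝ≥0∞) : EReal)
      ≤ abscissa U := by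
  obtain ⟨C, hC⟩ := exists_card_quotient_congruenceSubgroup_le G hδ U hU
  have hfin := finite_quotient_congruenceSubgroup U
  have hq : (1 : ℝ) < Nat.card 𝓀[K] := by exact_mod_cast Finite.one_lt_card
  have hh : ∀ k, (Nat.card (U ⧸ congruenceSubgroup U k) : ℝ) ≤
      C * ((Nat.card 𝓀[K] : ℝ) ^ k) ^ δ := fun k => by exact_mod_cast hC k
  have hc0 : ∀ k, 0 < numConjClasses U k := fun k =>
    have : Nonempty (ConjClasses (U ⧸ congruenceSubgroup U k)) := ⟨ConjClasses.mk 1⟩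
    Nat.card_pos
  have hch : ∀ k, numConjClasses U k ≤ Nat.card (U ⧸ congruenceSubgroup U k) := fun k =>
    Nat.card_le_card_of_surjective _ ConjClasses.mk_surjective
  have hC0 : 0 < C := by
    refine Nat.pos_of_ne_zero fun h => ?_
    have h1 := (hc0 0).trans_le ((hch 0).trans (hC 0))
    simp [h] at h1
  have hR : ∀ k N, ∃ s : ℕ, (s : ℕ∞) ≤ numIrrLE U N ∧ numConjClasses U k * (N + 1) ^ 2 ≤
      s * (N + 1) ^ 2 + Nat.card (U ⧸ congruenceSubgroup U k) := fun k N =>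
    exists_le_numIrrLE _ (QuotientGroup.mk'_surjective _)
      (isLocallyConstant_mk_congruenceSubgroup U k) N
  have hle : classGrowth U ≤ (δ : ℝ≥0∞) := limsup_ofReal_logb_div_le hq hC0 hc0 fun k =>
    le_trans (by exact_mod_cast hch k) (hh k)
  have hmain : ((2 * classGrowth U / ((δ : ℝ≥0∞) - classGrowth U) : ℝ≥0∞) : EReal) ≤
      abscissa U := by
    have hpos : 0 ≤ abscissa U := zero_le_limsup_log_div_log hc0 hR
    refine EReal.ge_of_forall_gt_iff_ge.1 fun z hz => ?_
    rcases le_or_gt z 0 with hz0 | hz0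
    · exact le_trans (by exact_mod_cast hz0) hpos
    have hfinγ : classGrowth U ≠ ∞ := ne_top_of_le_ne_top (ENNReal.natCast_ne_top δ) hle
    obtain ⟨g, hg⟩ : ∃ g : NNReal, classGrowth U = g := ⟨_, (ENNReal.coe_toNNReal hfinγ).symm⟩
    have hz1 : ENNReal.ofReal z < 2 * classGrowth U / ((δ : ℝ≥0∞) - classGrowth U) := by
      rw [← EReal.coe_ennreal_lt_coe_ennreal_iff, EReal.coe_ennreal_ofReal, max_eq_left hz0.le]
      exact hz
    have hgδ : (g : ℝ) ≤ δ := by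
      rw [hg] at hle
      exact_mod_cast hle
    have hz2 : z * (δ - g) < 2 * g := by
      have h1 := ENNReal.mul_lt_of_lt_div hz1
      rw [hg, ← ENNReal.ofReal_coe_nnreal, ← ENNReal.ofReal_natCast,
        ← ENNReal.ofReal_sub _ g.coe_nonneg,
        ← ENNReal.ofReal_mul hz0.le, ← ENNReal.ofReal_ofNat,
        ← ENNReal.ofReal_mul (by norm_num)] at h1
      exact (ENNReal.ofReal_lt_ofReal_iff_of_nonneg
        (mul_nonneg hz0.le (sub_nonneg.2 hgδ))).1 h1
    -- any `γ` between `z * δ / (2 + z)` and the class growth `g` satisfies the same inequality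
    obtain ⟨γ, hγ1, hγ2⟩ := exists_between (show z * δ / (2 + z) < g by
      rw [div_lt_iff₀ (by linarith)]; linarith)
    have hγ0 : 0 ≤ γ := le_trans (by positivity) hγ1.le
    rw [div_lt_iff₀ (by linarith)] at hγ1
    refine le_limsup_log_div_log hq hC0 hh hR (hγ2.trans_le hgδ) hz0 (by linarith) ?_
    have hγlt : ENNReal.ofReal γ < classGrowth U := by
      rw [hg, ← ENNReal.ofReal_coe_nnreal]
      exact (ENNReal.ofReal_lt_ofReal_iff_of_nonneg hγ0).2 hγ2
    refine (Filter.frequently_lt_of_lt_limsup (by isBoundedDefault) hγlt).mono fun k hk => ?_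
    have h1 := (ENNReal.ofReal_lt_ofReal_iff_of_nonneg hγ0).1 hk
    have hk0 : (0 : ℝ) < k := by
      rcases Nat.eq_zero_or_pos k with rfl | h
      · simp at h1
        linarith
      · exact_mod_cast h
    rw [lt_div_iff₀ hk0, Real.lt_logb_iff_rpow_lt hq (by exact_mod_cast hc0 k)] at h1
    exact h1.le
  refine ⟨hle, hmain, ?_⟩
  rw [ENNReal.two_mul_div_div_one_sub_div hle (ENNReal.natCast_ne_top δ)]
  exact hmain
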